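/- Let $X$ be a finite set, let $f:2^X\to\mathbb{R}_{\ge 0}$ be monotone and submodular, and let $p\ge 1$. Let $\{\mathcal M_\ell=(X_\ell,\mathcal I_\ell)\}_\ell$ be a finite $p$-matchoid on $X$, i.e. a finite family of matroids with $X_\ell\subseteq X$ such that every $e\in X$ lies in at most $p$ of the sets $X_\ell$. A set $S\subseteq X$ is independent if $S\cap X_\ell\in\mathcal I_\ell$ for all $\ell$. Let $k$ be the maximum size of an independent set and let $\mathit{OPT}$ be an independent set maximizing $f$. Write $f(x\mid S)=f(S\cup\{x\})-f(S)$. Let $\alpha\ge 0$ and $\beta_1,\dots,\beta_d>0$, put $S_0=\emptyset$, and for $i=1,\dots,d$ let $S_i$ be the output of the following pass. The pass reads a stream containing each element of $X$ exactly once (the order may depend on $i$). Let $\prec_i$ be the linear order on $X$ in which the elements of $S_{i-1}$ come first, ordered by $\prec_{i-1}$, followed by the elements of $X\setminus S_{i-1}$ in stream order ($\prec_1$ is simply the order of the first stream), and let $\nu(e,T)=f(e\mid\{t\in T:t\prec_i e\})$. Start with $S=S_{i-1}$ and process each arriving $x$ as follows. If $x\in S_{i-1}$, discard $x$. Otherwise,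 for every $\ell$ with $x\in X_\ell$ and $(S\cap X_\ell)\cup\{x\}\notin\mathcal I_\ell$, choose $t_\ell$ (ties broken arbitrarily) minimizing $\nu(t,S)$ over $T_\ell=\{y\in S\cap X_\ell:((S\cap X_\ell)\setminus\{y\})\cup\{x\}\in\mathcal I_\ell\}$; if some such $T_\ell$ is empty, $x$ is rejected. Let $C_x$ be the set of the chosen $t_\ell$. If $f(x\mid S)\ge\alpha+(1+\beta_i)\sum_{c\in C_x}\nu(c,S)$, replace $S$ by $(S\setminus C_x)\cup\{x\}$; otherwise reject $x$ and leave $S$ unchanged. After the whole stream has been read, set $S_i=S$. Let $1<i\le d$, suppose that $f(\mathit{OPT})\le\gamma_{i-1}f(S_{i-1})$ for a real number $\gamma_{i-1}$, and let $\delta_i=f(S_{i-1})/f(S_i)$ (with $\delta_i=0$ if $f(S_i)=0$). Then $$f(\mathit{OPT})\le\min\Bigl\{\gamma_{i-1}\delta_i,\ \bigl(\tfrac{p}{\beta_i}+p-1\bigr)(1-\delta_i)+p+\beta_i p+1\Bigr\}\cdot f(S_i)+k\alpha .$$ -/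

import Mathlib

namespace StreamingMatchoid

section Basic

variable {X : Type*} [DecidableEq X] {ι : Type*}

/-- Submodularity of a set function on the subsets of a finite ground set `X`. -/
def IsSubmodular (f : Finset X → ℝ) : Prop :=
  ∀ A B : Finset X, f (A ∪ B) + f (A ∩ B) ≤ f A + f B

/-- The marginal value `f(x | S) = f(S + x) - f(S)`. -/
def marginal (f : Finset X → ℝ) (x : X) (S : Finset X) : ℝ :=
  f (insert x S) - f S

/-- A family of matroids `M ℓ = (X_ℓ, I_ℓ)` with ground sets `X_ℓ = (M ℓ).E ⊆ X` is a
`p`-matchoid if every element of `X` lies in at most `p` of the ground sets. -/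
def IsMatchoid (p : ℕ) (M : ι → Matroid X) : Prop :=
  ∀ e : X, {ℓ : ι | e ∈ (M ℓ).E}.ncard ≤ p

/-- `S_ℓ = S ∩ X_ℓ`. -/
def restr (M : ι → Matroid X) (S : Finset X) (ℓ : ι) : Set X :=
  (S : Set X) ∩ (M ℓ).E

/-- `S` is independent in the matchoid if `S ∩ X_ℓ` is independent in `M ℓ` for all `ℓ`. -/
def Feasible (M : ι → Matroid X) (S : Finset X) : Prop :=
  ∀ ℓ : ι, (M ℓ).Indep (restr M S ℓ)

/-- `k` is the rank of the matchoid: the maximum size of an independent set. -/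
def IsRank (M : ι → Matroid X) (k : ℕ) : Prop :=
  IsGreatest {n : ℕ | ∃ T : Finset X, Feasible M T ∧ T.card = n} k

/-- `OPT` is an independent set of maximum value. -/
def IsOptimal (f : Finset X → ℝ) (M : ι → Matroid X) (OPT : Finset X) : Prop :=
  Feasible M OPT ∧ ∀ T : Finset X, Feasible M T → f T ≤ f OPT

/-- A stream presents every element of the ground set exactly once. -/
def IsStream (L : List X) : Prop :=
  L.Nodup ∧ ∀ x : X, x ∈ L

/-- The incremental value `ν(e, T) = f(e | {t' ∈ T : t' ≺ e})`, where `t' ≺ e` means that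
`t'` stands before `e` in the list `ord`. -/
def incr (f : Finset X → ℝ) (ord : List X) (e : X) (T : Finset X) : ℝ :=
  marginal f e (T.filter (fun t => ord.idxOf t < ord.idxOf e))

/-- The indices `ℓ` with `x ∈ X_ℓ` and `S_ℓ + x ∉ I_ℓ`. -/
def blocking (M : ι → Matroid X) (S : Finset X) (x : X) : Set ι :=
  {ℓ | x ∈ (M ℓ).E ∧ ¬ (M ℓ).Indep (insert x (restr M S ℓ))}

/-- `T_ℓ = {y ∈ S_ℓ : S_ℓ - y + x ∈ I_ℓ}`. -/
def candidates (M : ι → Matroid X) (S : Finset X) (x : X) (ℓ : ι) : Set X :=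
  {y | y ∈ restr M S ℓ ∧ (M ℓ).Indep (insert x (restr M S ℓ \ {y}))}

/-- `C` is a possible output `C_x` of `Exchange(x, S)`: it consists of one element of
`argmin_{t ∈ T_ℓ} ν(t, S)` for each blocking `ℓ`, ties being broken arbitrarily.
If `T_ℓ` is empty for some blocking `ℓ` there is no output. -/
def IsExchange (f : Finset X → ℝ) (M : ι → Matroid X) (ord : List X)
    (S : Finset X) (x : X) (C : Finset X) : Prop :=
  ∃ t : ι → X,
    (∀ ℓ ∈ blocking M S x, t ℓ ∈ candidates M S x ℓ ∧
      ∀ y ∈ candidates M S x ℓ, incr f ord (t ℓ) S ≤ incr f ord y S) ∧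
    (C : Set X) = t '' blocking M S x

/-- The acceptance test `f(x | S) ≥ α + (1 + β) ∑_{c ∈ C_x} ν(c, S)`. -/
def Accepts (f : Finset X → ℝ) (ord : List X) (α β : ℝ)
    (S : Finset X) (x : X) (C : Finset X) : Prop :=
  α + (1 + β) * ∑ c ∈ C, incr f ord c S ≤ marginal f x S

/-- `S'` is a possible current solution after the element `x` has been processed with current
solution `S`, in a pass that started from `Sinit`. An element that cannot be exchanged into
the solution at all (a loop of one of the matroids) is rejected. -/
inductive Step (f : Finset X → ℝ) (M : ι → Matroid X) (ord : List X) (α β : ℝ)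
    (Sinit : Finset X) (S : Finset X) (x : X) : Finset X → Prop
  | discard : x ∈ Sinit → Step f M ord α β Sinit S x S
  | accept (C : Finset X) : x ∉ Sinit → IsExchange f M ord S x C →
      Accepts f ord α β S x C → Step f M ord α β Sinit S x (insert x (S \ C))
  | reject (C : Finset X) : x ∉ Sinit → IsExchange f M ord S x C →
      ¬ Accepts f ord α β S x C → Step f M ord α β Sinit S x S
  | loop : x ∉ Sinit → (∀ C, ¬ IsExchange f M ord S x C) → Step f M ord α β Sinit S x S

/-- `S'` is a possible current solution after the elements of the list have been processed one
after the other, starting with current solution `S`. -/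
def RunOn (f : Finset X → ℝ) (M : ι → Matroid X) (ord : List X) (α β : ℝ)
    (Sinit : Finset X) : List X → Finset X → Finset X → Prop
  | [], S, S' => S' = S
  | x :: L, S, S' => ∃ S₁, Step f M ord α β Sinit S x S₁ ∧ RunOn f M ord α β Sinit L S₁ S'

/-- `S'` is a possible output of `StreamingLocalSearch(α, β, Sinit)` on the stream `L`, where
incremental values are taken with respect to the order `ord`. -/
def StreamingLocalSearch (f : Finset X → ℝ) (M : ι → Matroid X) (ord : List X) (α β : ℝ)
    (L : List X) (Sinit S' : Finset X) : Prop :=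
  RunOn f M ord α β Sinit L Sinit S'

/-- The pretend order `≺` of each pass, for the streams `σ 1, σ 2, …` and solutions
`S 0, S 1, …`: in pass `i + 1` first come the elements of `S i`, in the pretend order of
pass `i`, then all other elements in the order of the stream `σ (i + 1)`. -/
def pretendOrder (σ : ℕ → List X) (S : ℕ → Finset X) : ℕ → List X
  | 0 => []
  | i + 1 => (pretendOrder σ S i).filter (fun x => x ∈ S i) ++
      (σ (i + 1)).filter (fun x => x ∉ S i)

/-- `S 0, …, S d` are the solutions produced by a run of
`MultipassLocalSearch(α, β 1, …, β d)`, pass `i` reading the stream `σ i`. -/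
def MultipassLocalSearch (f : Finset X → ℝ) (M : ι → Matroid X) (α : ℝ) (β : ℕ → ℝ)
    (d : ℕ) (σ : ℕ → List X) (S : ℕ → Finset X) : Prop :=
  S 0 = ∅ ∧ ∀ i, 1 ≤ i → i ≤ d →
    StreamingLocalSearch f M (pretendOrder σ S i) α (β i) (σ i) (S (i - 1)) (S i)

end Basic

end StreamingMatchoid

namespace StreamingMatchoid

/-! ### Marginal and incremental values of a monotone submodular function -/

section Submodular

variable {X : Type*} [DecidableEq X] {f : Finset X → ℝ}

/-! The bound by γδ is immediate from δ·f(S_i) = f(S_{i-1}). The other bound is a charging argument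
within one pass. Let D be the set of elements deleted in the pass and χ(y) the incremental value of
y when deleted. An accepted exchange raises f by at least β times the χ-value it deletes, so β·χ(D)
≤ f(S_i) - f(S_{i-1}) = (1-δ) f(S_i); moreover f(S_i ∪ D) ≤ f(S_i) + χ(D).

A rejected non-loop x has marginal at most α + (1+β) ∑ w_ℓ, and whenever w_ℓ > 0, x is spanned in
matroid ℓ by elements of value at least w_ℓ. Later exchanges preserve this
(`chargeable_subset_closure`): the deleted t_ℓ lies on a circuit whose other elements are worth at
least as much, and an element deleted only for other matroids stays available at its frozen value.
So an element of S_i is charged in at most p matroids, an element of D in at most p-1. Hall's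
theorem (`sum_le_sum_of_mem_closure`) turns spanning into an injective charging in each matroid,
whence `PassInvariant.value_le`: f(OPT) ≤ f(S_i) + χ(D) + kα + (1+β)(p f(S_i) + (p-1) χ(D)).
Inserting the bound on χ(D) finishes the proof. -/

lemma marginal_nonneg (hmono : Monotone f) (x : X) (S : Finset X) : 0 ≤ marginal f x S :=
  sub_nonneg.2 (hmono (Finset.subset_insert x S))

lemma incr_nonneg (hmono : Monotone f) (ord : List X) (x : X) (S : Finset X) :
    0 ≤ incr f ord x S :=
  marginal_nonneg hmono _ _

/-- Decreasing marginal values. -/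
lemma marginal_anti (hsub : IsSubmodular f) (hmono : Monotone f) (x : X) {S T : Finset X}
    (hTS : T ⊆ S) : marginal f x S ≤ marginal f x T := by
  -- For x ∈ S the left side is 0, and it is monotonicity that makes the right side nonnegative.
  by_cases hx : x ∈ S
  · have := marginal_nonneg hmono x T
    simpa [marginal, Finset.insert_eq_of_mem hx] using this
  · have h := hsub S (insert x T)
    have h1 : S ∪ insert x T = insert x S := by
      rw [Finset.union_insert, Finset.union_eq_left.2 hTS]
    have h2 : S ∩ insert x T = T := by
      rw [Finset.inter_insert_of_notMem hx, Finset.inter_eq_right.2 hTS]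
    rw [h1, h2] at h
    unfold marginal
    linarith

lemma incr_anti (hsub : IsSubmodular f) (hmono : Monotone f) (ord : List X) (x : X)
    {S T : Finset X} (hTS : T ⊆ S) : incr f ord x S ≤ incr f ord x T :=
  marginal_anti hsub hmono x (Finset.filter_subset_filter _ hTS)

/-- The incremental values of a set add up to its value. -/
lemma sum_incr (f : Finset X → ℝ) {ord : List X} (S : Finset X) (hS : ∀ x ∈ S, x ∈ ord) :
    ∑ e ∈ S, incr f ord e S = f S - f ∅ := by
  -- Adding elements in the given order makes the sum telescope: the last element leaves the earlier
  -- incremental values untouched.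
  induction S using Finset.induction_on_max_value (fun x => ord.idxOf x) with
  | empty => simp
  | insert a S ha hmax ih =>
    have hlt : ∀ x ∈ S, ord.idxOf x < ord.idxOf a := by
      intro x hx
      refine lt_of_le_of_ne (hmax x hx) fun h => ha ?_
      rw [List.idxOf_inj (hS x (Finset.mem_insert_of_mem hx))] at h
      exact h ▸ hx
    have h1 : incr f ord a (insert a S) = f (insert a S) - f S := by
      unfold incr marginal
      rw [Finset.filter_insert, if_neg (lt_irrefl _), Finset.filter_true_of_mem hlt]
    have h2 : ∀ e ∈ S, incr f ord e (insert a S) = incr f ord e S := by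
      intro e he
      unfold incr
      rw [Finset.filter_insert, if_neg (hlt e he).not_gt]
    rw [Finset.sum_insert ha, h1, Finset.sum_congr rfl h2,
      ih fun x hx => hS x (Finset.mem_insert_of_mem hx)]
    ring

/-- Telescope both f S and f (S \ C): the surviving elements have no smaller incremental value after
the deletion, so the loss is at most the share of C. -/
lemma sub_sdiff_le_sum_incr (hsub : IsSubmodular f) (hmono : Monotone f) {ord : List X}
    {S C : Finset X} (hS : ∀ x ∈ S, x ∈ ord) (hC : C ⊆ S) :
    f S - f (S \ C) ≤ ∑ c ∈ C, incr f ord c S := by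
  have h1 := sum_incr f S hS
  have h2 := sum_incr f (S \ C) fun x hx => hS x (Finset.mem_sdiff.1 hx).1
  have h3 := Finset.sum_sdiff (f := fun e => incr f ord e S) hC
  have h4 : ∑ e ∈ S \ C, incr f ord e S ≤ ∑ e ∈ S \ C, incr f ord e (S \ C) :=
    Finset.sum_le_sum fun e _ => incr_anti hsub hmono ord e Finset.sdiff_subset
  linarith

lemma le_add_sum_marginal (hsub : IsSubmodular f) (hmono : Monotone f) (A T : Finset X) :
    f (A ∪ T) ≤ f A + ∑ x ∈ T, marginal f x A := by
  induction T using Finset.induction_on with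
  | empty => simp
  | insert a T ha ih =>
    have h := marginal_anti hsub hmono a (Finset.subset_union_left : A ⊆ A ∪ T)
    rw [Finset.sum_insert ha, Finset.union_insert]
    unfold marginal at h ih ⊢
    linarith

/-- Exchanging `x`, which comes after all of `S`, for `C` does not decrease incremental values. -/
lemma incr_le_incr_exchange (hsub : IsSubmodular f) (hmono : Monotone f) {ord : List X}
    {S : Finset X} (C : Finset X) {x y : X} (hy : ord.idxOf y < ord.idxOf x) :
    incr f ord y S ≤ incr f ord y (insert x (S \ C)) := by
  unfold incr
  rw [Finset.filter_insert, if_neg hy.not_gt]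
  exact marginal_anti hsub hmono y (Finset.filter_subset_filter _ Finset.sdiff_subset)

lemma marginal_le_incr_exchange (hsub : IsSubmodular f) (hmono : Monotone f) (ord : List X)
    {S : Finset X} (C : Finset X) (x : X) :
    marginal f x S ≤ incr f ord x (insert x (S \ C)) := by
  unfold incr
  rw [Finset.filter_insert, if_neg (lt_irrefl _)]
  exact marginal_anti hsub hmono x ((Finset.filter_subset _ _).trans Finset.sdiff_subset)

end Submodular

/-! ### Spanning, weights and fundamental circuits -/

section Matroid

variable {X : Type*} [DecidableEq X]

/-- If each element of positive weight of an independent set is spanned by the elements of `Q`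
of at least that weight, then the independent set weighs at most as much as `Q`. -/
lemma sum_le_sum_of_mem_closure (N : Matroid X) (P Q : Finset X) (a b : X → ℝ)
    (hP : N.Indep (P : Set X)) (hb : ∀ y ∈ Q, 0 ≤ b y)
    (h : ∀ x ∈ P, 0 < a x → x ∈ N.closure {y | y ∈ Q ∧ a x ≤ b y}) :
    ∑ x ∈ P, a x ≤ ∑ y ∈ Q, b y := by
  classical
  set P' := P.filter (fun x => 0 < a x) with hP'
  have hmem : ∀ x : P', (x : X) ∈ P ∧ 0 < a x := fun x => Finset.mem_filter.1 x.2
  -- Hall's condition is a rank inequality: a subset s of P' is independent and spanned by the union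
  -- of its neighbourhoods, so it has at most as many elements as that union.
  obtain ⟨g, hg, hgt⟩ := (Finset.all_card_le_biUnion_card_iff_exists_injective
    (fun x : P' => Q.filter (fun y => a x ≤ b y))).1 (by
      intro s
      have hs : N.Indep (((s.map (Function.Embedding.subtype _) : Finset X)) : Set X) := by
        refine hP.subset fun x hx => ?_
        obtain ⟨y, -, rfl⟩ := Finset.mem_map.1 (Finset.mem_coe.1 hx)
        exact (hmem y).1
      have hcl : ((s.map (Function.Embedding.subtype _) : Finset X) : Set X) ⊆
          N.closure (s.biUnion fun x : P' => Q.filter (fun y => a x ≤ b y) : Finset X) := by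
        intro x hx
        obtain ⟨y, hy, rfl⟩ := Finset.mem_map.1 (Finset.mem_coe.1 hx)
        refine N.closure_subset_closure ?_ (h y (hmem y).1 (hmem y).2)
        intro z hz
        exact Finset.mem_coe.2 (Finset.mem_biUnion.2 ⟨y, hy, Finset.mem_filter.2 hz⟩)
      have := (hs.encard_le_eRk_of_subset hcl).trans
        ((N.eRk_closure_eq _).le.trans (N.eRk_le_encard _))
      rw [Set.encard_coe_eq_coe_finsetCard, Set.encard_coe_eq_coe_finsetCard,
        Finset.card_map] at this
      exact_mod_cast this)
  calc ∑ x ∈ P, a x ≤ ∑ x ∈ P', a x := by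
        rw [hP', Finset.sum_filter]
        refine Finset.sum_le_sum fun x _ => ?_
        split_ifs with h0
        · exact le_rfl
        · exact not_lt.1 h0
    _ = ∑ x : P', a x := (Finset.sum_coe_sort P' a).symm
    _ ≤ ∑ x : P', b (g x) := Finset.sum_le_sum fun x _ => (Finset.mem_filter.1 (hgt x)).2
    _ = ∑ y ∈ Finset.univ.map ⟨g, hg⟩, b y := by simp
    _ ≤ ∑ y ∈ Q, b y := by
        refine Finset.sum_le_sum_of_subset_of_nonneg ?_ fun y hy _ => hb y hy
        intro y hy
        obtain ⟨x, -, rfl⟩ := Finset.mem_map.1 hy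
        exact (Finset.mem_filter.1 (hgt x)).1

variable {ι : Type*} {M : ι → Matroid X} {S : Finset X} {x : X} {ℓ : ι}

/-- This is the fundamental circuit of x over S_ℓ: its elements are those whose removal from S_ℓ + x
restores independence. -/
lemma isCircuit_insert_candidates (hS : Feasible M S) (hx : x ∉ S)
    (hℓ : ℓ ∈ blocking M S x) :
    (M ℓ).IsCircuit (insert x (candidates M S x ℓ)) := by
  have hcl : x ∈ (M ℓ).closure (restr M S ℓ) :=
    (hS ℓ).mem_closure_iff'.2 ⟨hℓ.1, fun h => absurd h hℓ.2⟩
  have hxS : x ∉ restr M S ℓ := fun h => hx h.1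
  convert (hS ℓ).fundCircuit_isCircuit hcl hxS using 1
  ext y
  rw [(hS ℓ).mem_fundCircuit_iff hcl hxS]
  by_cases hyx : y = x
  · subst hyx
    simp [(hS ℓ).sdiff]
  · rw [← Set.insert_sdiff_singleton_comm (Ne.symm hyx)]
    simp only [Set.mem_insert_iff, hyx, false_or]
    refine ⟨fun h => h.2, fun h => ⟨?_, h⟩⟩
    by_contra hy
    rw [Set.sdiff_singleton_eq_self hy] at h
    exact hℓ.2 h

lemma mem_closure_candidates (hS : Feasible M S) (hx : x ∉ S) (hℓ : ℓ ∈ blocking M S x) :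
    x ∈ (M ℓ).closure (candidates M S x ℓ) := by
  have h := (isCircuit_insert_candidates hS hx hℓ).mem_closure_sdiff_singleton_of_mem
    (Set.mem_insert _ _)
  exact (M ℓ).closure_subset_closure (by simp) h

/-- An element that is independent on its own can always be exchanged into the solution. -/
lemma exists_isExchange [Finite ι] (f : Finset X → ℝ) (ord : List X) (hS : Feasible M S)
    (hx : x ∉ S) (hne : ∀ ℓ, x ∈ (M ℓ).E → (M ℓ).Indep {x}) :
    ∃ C, IsExchange f M ord S x C := by
  classical
  have hcand : ∀ ℓ ∈ blocking M S x, ∃ t ∈ candidates M S x ℓ,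
      ∀ y ∈ candidates M S x ℓ, incr f ord t S ≤ incr f ord y S := by
    intro ℓ hℓ
    have hfin : (candidates M S x ℓ).Finite :=
      S.finite_toSet.subset fun y hy => hy.1.1
    refine Set.exists_min_image _ _ hfin ?_
    -- With no candidates the circuit would be {x}, making x a loop.
    by_contra hemp
    rw [Set.not_nonempty_iff_eq_empty] at hemp
    have hc := isCircuit_insert_candidates hS hx hℓ
    rw [hemp] at hc
    exact hc.not_indep (by simpa using hne ℓ hℓ.1)
  have : Nonempty X := ⟨x⟩
  choose! t ht hmin using hcand
  refine ⟨(Set.toFinite (t '' blocking M S x)).toFinset, t,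
    fun ℓ hℓ => ⟨ht ℓ hℓ, hmin ℓ hℓ⟩, Set.Finite.coe_toFinset _⟩

end Matroid

/-! ### The charging invariant of one pass -/

section Pass

variable {X : Type*} [DecidableEq X] {ι : Type*} {f : Finset X → ℝ} {M : ι → Matroid X}
  {ord : List X} {α β : ℝ} {Sinit : Finset X}

/-- The elements that can be charged in `M ℓ` with a weight of at least `θ`: elements of the
current solution `S`, valued by `ν(·, S)`, and elements of the set `D` of deleted elements that
were not deleted on behalf of `M ℓ` (`V y ℓ`), valued by their value `χ` on deletion. -/
def chargeable (f : Finset X → ℝ) (M : ι → Matroid X) (ord : List X) (S D : Finset X)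
    (χ : X → ℝ) (V : X → ι → Prop) (ℓ : ι) (θ : ℝ) : Set X :=
  {y | y ∈ (M ℓ).E ∧ ((y ∈ S ∧ θ ≤ incr f ord y S) ∨ (y ∈ D ∧ ¬ V y ℓ ∧ θ ≤ χ y))}

/-- The element `x` was rejected, and its marginal value is charged to weights `w ℓ` at which it
is spanned by chargeable elements. -/
def Charged [Fintype ι] (f : Finset X → ℝ) (M : ι → Matroid X) (ord : List X) (α β : ℝ)
    (S D : Finset X) (χ : X → ℝ) (V : X → ι → Prop) (x : X) : Prop :=
  ∃ w : ι → ℝ, marginal f x (S ∪ D) ≤ α + (1 + β) * ∑ ℓ, w ℓ ∧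
    ∀ ℓ, 0 < w ℓ → x ∈ (M ℓ).closure (chargeable f M ord S D χ V ℓ (w ℓ))

/-- What holds in a pass started from `Sinit` when the elements of `pre` have been processed,
the current solution is `S`, and `D` is the set of the elements deleted so far. -/
structure PassInvariant [Fintype ι] (f : Finset X → ℝ) (M : ι → Matroid X) (ord : List X)
    (α β : ℝ) (Sinit : Finset X) (pre : List X) (S D : Finset X) (χ : X → ℝ)
    (V : X → ι → Prop) : Prop where
  feasible : Feasible M S
  disjoint : Disjoint S D
  init_subset : Sinit ⊆ S ∪ D
  subset : ∀ x ∈ S ∪ D, x ∈ Sinit ∨ x ∈ pre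
  value_union : f (S ∪ D) ≤ f S + ∑ y ∈ D, χ y
  value_init : f Sinit + β * ∑ y ∈ D, χ y ≤ f S
  nonneg : ∀ y ∈ D, 0 ≤ χ y
  deleted : ∀ y ∈ D, ∃ ℓ, y ∈ (M ℓ).E ∧ V y ℓ
  charged : ∀ x ∈ pre, (∀ ℓ, x ∈ (M ℓ).E → (M ℓ).Indep {x}) → x ∈ S ∪ D ∨
    Charged f M ord α β S D χ V x

lemma PassInvariant.start [Fintype ι] (hinit : Feasible M Sinit) :
    PassInvariant f M ord α β Sinit [] Sinit ∅ (fun _ => 0) (fun _ _ => False) where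
  feasible := hinit
  disjoint := Finset.disjoint_empty_right _
  init_subset := Finset.subset_union_left
  subset x hx := by simpa using hx
  value_union := by simp
  value_init := by simp
  nonneg := by simp
  deleted := by simp
  charged := by simp

lemma IsExchange.subset {S C : Finset X} {x : X} (h : IsExchange f M ord S x C) : C ⊆ S := by
  obtain ⟨t, ht, hC⟩ := h
  intro c hc
  have : c ∈ t '' blocking M S x := hC ▸ Finset.mem_coe.2 hc
  obtain ⟨ℓ, hℓ, rfl⟩ := this
  exact (ht ℓ hℓ).1.1.1

lemma IsExchange.feasible {S C : Finset X} {x : X} (hx : x ∉ S) (hS : Feasible M S)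
    (h : IsExchange f M ord S x C) : Feasible M (insert x (S \ C)) := by
  obtain ⟨t, ht, hC⟩ := h
  intro ℓ
  by_cases hxE : x ∈ (M ℓ).E
  · by_cases hb : ℓ ∈ blocking M S x
    · have htC : t ℓ ∈ C := by
        rw [← Finset.mem_coe, hC]
        exact ⟨ℓ, hb, rfl⟩
      refine (ht ℓ hb).1.2.subset ?_
      rintro y ⟨hy, hyE⟩
      rcases Finset.mem_insert.1 (Finset.mem_coe.1 hy) with rfl | hy
      · exact Set.mem_insert _ _
      · obtain ⟨hyS, hyC⟩ := Finset.mem_sdiff.1 hy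
        exact Set.mem_insert_of_mem _ ⟨⟨hyS, hyE⟩, fun h => hyC (h ▸ htC)⟩
    · have hind : (M ℓ).Indep (insert x (restr M S ℓ)) := by
        by_contra hcon
        exact hb ⟨hxE, hcon⟩
      refine hind.subset ?_
      rintro y ⟨hy, hyE⟩
      rcases Finset.mem_insert.1 (Finset.mem_coe.1 hy) with rfl | hy
      · exact Set.mem_insert _ _
      · exact Set.mem_insert_of_mem _ ⟨(Finset.mem_sdiff.1 hy).1, hyE⟩
  · refine (hS ℓ).subset ?_
    rintro y ⟨hy, hyE⟩
    rcases Finset.mem_insert.1 (Finset.mem_coe.1 hy) with rfl | hy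
    · exact absurd hyE hxE
    · exact ⟨(Finset.mem_sdiff.1 hy).1, hyE⟩

/-- An accepted exchange loses no span: chargeable elements stay in the closure of the
chargeable elements. -/
lemma chargeable_subset_closure (hsub : IsSubmodular f) (hmono : Monotone f)
    {S D C : Finset X} {χ : X → ℝ} {V : X → ι → Prop} {x : X} {t : ι → X}
    (hS : Feasible M S) (hx : x ∉ S) (hdisj : Disjoint S D) (hCS : C ⊆ S)
    (ht : ∀ ℓ ∈ blocking M S x, t ℓ ∈ candidates M S x ℓ ∧
      ∀ y ∈ candidates M S x ℓ, incr f ord (t ℓ) S ≤ incr f ord y S)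
    (hC : (C : Set X) = t '' blocking M S x)
    (hlt : ∀ y ∈ S, ord.idxOf y < ord.idxOf x)
    (hval : ∀ c ∈ C, incr f ord c S ≤ marginal f x S) (ℓ : ι) (θ : ℝ) :
    chargeable f M ord S D χ V ℓ θ ⊆ (M ℓ).closure
      (chargeable f M ord (insert x (S \ C)) (D ∪ C)
        (fun y => if y ∈ C then incr f ord y S else χ y)
        (fun y m => if y ∈ C then m ∈ blocking M S x ∧ t m = y else V y m) ℓ θ) := by
  set N := chargeable f M ord (insert x (S \ C)) (D ∪ C)
        (fun y => if y ∈ C then incr f ord y S else χ y)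
        (fun y m => if y ∈ C then m ∈ blocking M S x ∧ t m = y else V y m) ℓ θ with hN
  have hNE : N ⊆ (M ℓ).E := fun y hy => hy.1
  have hNcl : N ⊆ (M ℓ).closure N := (M ℓ).subset_closure N
  -- Only t ℓ is lost in matroid ℓ: other deleted elements remain chargeable there at their frozen
  -- value, and survivors do not lose value because x comes last in the order.
  have hkeep : ∀ y ∈ S, y ∈ (M ℓ).E → θ ≤ incr f ord y S →
      ¬ (ℓ ∈ blocking M S x ∧ t ℓ = y) → y ∈ N := by
    intro y hyS hyE hθ hyt
    refine ⟨hyE, ?_⟩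
    by_cases hyC : y ∈ C
    · exact Or.inr ⟨Finset.mem_union_right _ hyC, by simpa only [hyC, if_true] using hyt,
        by simpa only [hyC, if_true] using hθ⟩
    · exact Or.inl ⟨Finset.mem_insert_of_mem (Finset.mem_sdiff.2 ⟨hyS, hyC⟩),
        hθ.trans (incr_le_incr_exchange hsub hmono C (hlt y hyS))⟩
  rintro y ⟨hyE, ⟨hyS, hθ⟩ | ⟨hyD, hyV, hθ⟩⟩
  · by_cases hyt : ℓ ∈ blocking M S x ∧ t ℓ = y
    · obtain ⟨hb, rfl⟩ := hyt
      have htC : t ℓ ∈ C := by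
        rw [← Finset.mem_coe, hC]
        exact ⟨ℓ, hb, rfl⟩
      -- The rest of the circuit spans t ℓ and is worth at least as much: the other candidates by
      -- minimality of t ℓ, and x by `hval`.
      have hcirc := (isCircuit_insert_candidates hS hx hb).mem_closure_sdiff_singleton_of_mem
        (Set.mem_insert_of_mem x (ht ℓ hb).1)
      refine (M ℓ).closure_subset_closure ?_ hcirc
      rintro z ⟨rfl | hz, hzt⟩
      · exact ⟨hb.1, Or.inl ⟨Finset.mem_insert_self _ _,
          (hθ.trans (hval _ htC)).trans (marginal_le_incr_exchange hsub hmono ord C z)⟩⟩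
      · exact hkeep z hz.1.1 hz.1.2 (hθ.trans ((ht ℓ hb).2 z hz)) fun h => hzt h.2.symm
    · exact hNcl (hkeep y hyS hyE hθ hyt)
  · have hyC : y ∉ C := fun h => Finset.disjoint_left.1 hdisj (hCS h) hyD
    exact hNcl ⟨hyE, Or.inr ⟨Finset.mem_union_left _ hyD, by simpa only [hyC, if_false] using hyV,
      by simpa only [hyC, if_false] using hθ⟩⟩

/-- A rejected element is charged to the elements chosen for exchange. -/
lemma charged_of_reject [Fintype ι] (hmono : Monotone f) (hsub : IsSubmodular f) (hβ : 0 < β)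
    {S D C : Finset X} {χ : X → ℝ} {V : X → ι → Prop} {x : X}
    (hS : Feasible M S) (hx : x ∉ S) (hex : IsExchange f M ord S x C)
    (hrej : ¬ Accepts f ord α β S x C) : Charged f M ord α β S D χ V x := by
  classical
  obtain ⟨t, ht, hC⟩ := hex
  refine ⟨fun ℓ => if ℓ ∈ blocking M S x then incr f ord (t ℓ) S else 0, ?_, ?_⟩
  · have hsum : ∑ c ∈ C, incr f ord c S ≤
        ∑ ℓ, if ℓ ∈ blocking M S x then incr f ord (t ℓ) S else 0 := by
      have hCi : C = (Finset.univ.filter (· ∈ blocking M S x)).image t := by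
        rw [← Finset.coe_inj, hC]
        simp
      rw [← Finset.sum_filter, hCi]
      -- Only an inequality, since one element may be chosen for several matroids.
      exact Finset.sum_image_le_of_nonneg fun _ _ => incr_nonneg hmono _ _ _
    have h1 := not_le.1 hrej
    have h2 := marginal_anti hsub hmono x (Finset.subset_union_left : S ⊆ S ∪ D)
    have h3 := mul_le_mul_of_nonneg_left hsum (by linarith : 0 ≤ 1 + β)
    linarith
  · intro ℓ hpos
    by_cases hb : ℓ ∈ blocking M S x
    · simp only [hb, if_true]
      refine (M ℓ).closure_subset_closure ?_ (mem_closure_candidates hS hx hb)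
      exact fun y hy => ⟨hy.1.2, Or.inl ⟨hy.1.1, (ht ℓ hb).2 y hy⟩⟩
    · simp [hb] at hpos

/-- Only acceptance changes S. The exchanged elements then join D, with χ frozen at their current
incremental value and V recording the matroids that chose them. -/
lemma PassInvariant.step [Fintype ι] (hsub : IsSubmodular f) (hmono : Monotone f)
    (hα : 0 ≤ α) (hβ : 0 < β) (hord : ∀ x, x ∈ ord) {pre : List X} {S D S' : Finset X}
    {χ : X → ℝ} {V : X → ι → Prop} {x : X} (hxpre : x ∉ pre)
    (hlt : x ∉ Sinit → ∀ y, y ∈ Sinit ∨ y ∈ pre → ord.idxOf y < ord.idxOf x)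
    (inv : PassInvariant f M ord α β Sinit pre S D χ V)
    (hstep : Step f M ord α β Sinit S x S') :
    ∃ D' χ' V', PassInvariant f M ord α β Sinit (pre ++ [x]) S' D' χ' V' := by
  have hxSD : x ∉ Sinit → x ∉ S ∪ D := fun hx h => (inv.subset x h).elim hx hxpre
  have hstay : ((∀ ℓ, x ∈ (M ℓ).E → (M ℓ).Indep {x}) → x ∈ S ∪ D ∨
      Charged f M ord α β S D χ V x) →
      PassInvariant f M ord α β Sinit (pre ++ [x]) S D χ V := by
    intro h
    refine { inv with subset := fun y hy => ?_, charged := fun y hy => ?_ }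
    · rw [List.mem_append]
      exact (inv.subset y hy).imp_right Or.inl
    · rcases List.mem_append.1 hy with hy | hy
      · exact inv.charged y hy
      · rw [List.mem_singleton.1 hy]
        exact h
  cases hstep with
  | discard hx => exact ⟨D, χ, V, hstay fun _ => Or.inl (inv.init_subset hx)⟩
  | reject C hx hex hrej =>
    exact ⟨D, χ, V, hstay fun _ => Or.inr (charged_of_reject hmono hsub hβ inv.feasible
      (fun h => hxSD hx (Finset.mem_union_left _ h)) hex hrej)⟩
  | loop hx hno =>
    refine ⟨D, χ, V, hstay fun hne => ?_⟩
    obtain ⟨C, hC⟩ := exists_isExchange f ord inv.feasible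
      (fun h => hxSD hx (Finset.mem_union_left _ h)) hne
    exact absurd hC (hno C)
  | accept C hx hex hacc =>
    have hxS : x ∉ S := fun h => hxSD hx (Finset.mem_union_left _ h)
    have hxD : x ∉ D := fun h => hxSD hx (Finset.mem_union_right _ h)
    have hCS := hex.subset
    have hfeas := hex.feasible hxS inv.feasible
    obtain ⟨t, ht, hC⟩ := hex
    have hDC : Disjoint D C := inv.disjoint.symm.mono_right hCS
    have hunion : insert x (S \ C) ∪ (D ∪ C) = insert x (S ∪ D) := by
      ext y
      have := @hCS y
      simp only [Finset.mem_union, Finset.mem_insert, Finset.mem_sdiff]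
      tauto
    have hνC : ∀ c ∈ C, 0 ≤ incr f ord c S := fun c _ => incr_nonneg hmono _ _ _
    have h_sum_nonneg : 0 ≤ ∑ c ∈ C, incr f ord c S := Finset.sum_nonneg hνC
    have hacc' : α + (1 + β) * ∑ c ∈ C, incr f ord c S ≤ marginal f x S := hacc
    have h_gain_nonneg : 0 ≤ β * ∑ c ∈ C, incr f ord c S := mul_nonneg hβ.le h_sum_nonneg
    have hval : ∀ c ∈ C, incr f ord c S ≤ marginal f x S := fun c hc => by
      have := Finset.single_le_sum hνC hc
      linarith
    have hgain : f S + marginal f x S - ∑ c ∈ C, incr f ord c S ≤ f (insert x (S \ C)) := by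
      have h1 := sub_sdiff_le_sum_incr hsub hmono (fun y _ => hord y) hCS
      have h2 := marginal_anti hsub hmono x (Finset.sdiff_subset : S \ C ⊆ S)
      simp only [marginal] at h2 ⊢
      linarith
    have hsum : ∑ y ∈ D ∪ C, (if y ∈ C then incr f ord y S else χ y) =
        ∑ y ∈ D, χ y + ∑ c ∈ C, incr f ord c S := by
      rw [Finset.sum_union hDC]
      congr 1
      · exact Finset.sum_congr rfl fun y hy => if_neg (Finset.disjoint_left.1 hDC hy)
      · exact Finset.sum_congr rfl fun y hy => if_pos hy
    refine ⟨D ∪ C, fun y => if y ∈ C then incr f ord y S else χ y,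
      fun y m => if y ∈ C then m ∈ blocking M S x ∧ t m = y else V y m, ?_⟩
    refine
      { feasible := hfeas
        disjoint := ?_
        init_subset := ?_
        subset := ?_
        value_union := ?_
        value_init := ?_
        nonneg := ?_
        deleted := ?_
        charged := ?_ }
    · rw [Finset.disjoint_left]
      intro y hy hy'
      rcases Finset.mem_insert.1 hy with rfl | hy
      · exact (Finset.mem_union.1 hy').elim hxD fun h => hxS (hCS h)
      · obtain ⟨hyS, hyC⟩ := Finset.mem_sdiff.1 hy
        exact (Finset.mem_union.1 hy').elim (Finset.disjoint_left.1 inv.disjoint hyS) hyC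
    · rw [hunion]
      exact inv.init_subset.trans (Finset.subset_insert _ _)
    · rw [hunion]
      intro y hy
      rw [List.mem_append, List.mem_singleton]
      rcases Finset.mem_insert.1 hy with rfl | hy
      · exact Or.inr (Or.inr rfl)
      · exact (inv.subset y hy).imp_right Or.inl
    · rw [hunion, hsum]
      -- The union grows only by x, gaining at most f(x | S); the solution gains at least this minus
      -- ∑ ν(c, S), and the new χ terms make up the difference.
      have h1 := marginal_anti hsub hmono x (Finset.subset_union_left : S ⊆ S ∪ D)
      have h2 := inv.value_union
      simp only [marginal] at h1 hgain
      linarith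
    · rw [hsum]
      have := inv.value_init
      linarith
    · intro y hy
      by_cases hyC : y ∈ C
      · simpa only [hyC, if_true] using hνC y hyC
      · simpa only [hyC, if_false] using
          inv.nonneg y ((Finset.mem_union.1 hy).resolve_right hyC)
    · intro y hy
      by_cases hyC : y ∈ C
      · obtain ⟨ℓ, hℓ, rfl⟩ : y ∈ t '' blocking M S x := hC ▸ Finset.mem_coe.2 hyC
        exact ⟨ℓ, (ht ℓ hℓ).1.1.2, by simp only [hyC, if_true]; exact ⟨hℓ, trivial⟩⟩
      · simpa only [hyC, if_false] using
          inv.deleted y ((Finset.mem_union.1 hy).resolve_right hyC)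
    · intro y hy hne
      rw [List.mem_append, List.mem_singleton] at hy
      rcases hy with hy | rfl
      · rw [hunion]
        rcases inv.charged y hy hne with h | ⟨w, hw, hcl⟩
        · exact Or.inl (Finset.mem_insert_of_mem h)
        · refine Or.inr ⟨w, ?_, fun ℓ hℓ => ?_⟩
          · rw [hunion]
            exact (marginal_anti hsub hmono y (Finset.subset_insert _ _)).trans hw
          · exact (M ℓ).closure_subset_closure_of_subset_closure
              (chargeable_subset_closure hsub hmono inv.feasible hxS inv.disjoint hCS ht hC
                (fun z hz => hlt hx z (inv.subset z (Finset.mem_union_left _ hz))) hval ℓ (w ℓ))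
              (hcl ℓ hℓ)
      · exact Or.inl (Finset.mem_union_left _ (Finset.mem_insert_self _ _))

lemma PassInvariant.run [Fintype ι] (hsub : IsSubmodular f) (hmono : Monotone f)
    (hα : 0 ≤ α) (hβ : 0 < β) (hord : ∀ x, x ∈ ord) {L : List X} (hnd : L.Nodup)
    (hlt : ∀ pre x post, L = pre ++ x :: post → x ∉ Sinit →
      ∀ y, y ∈ Sinit ∨ y ∈ pre → ord.idxOf y < ord.idxOf x)
    (post : List X) {pre : List X} (hL : L = pre ++ post) {S D S' : Finset X}
    {χ : X → ℝ} {V : X → ι → Prop}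
    (inv : PassInvariant f M ord α β Sinit pre S D χ V)
    (hrun : RunOn f M ord α β Sinit post S S') :
    ∃ D' χ' V', PassInvariant f M ord α β Sinit L S' D' χ' V' := by
  induction post generalizing pre S D χ V with
  | nil =>
    obtain rfl : S' = S := hrun
    rw [List.append_nil] at hL
    exact ⟨D, χ, V, hL ▸ inv⟩
  | cons x post ih =>
    obtain ⟨S₁, hstep, hrest⟩ := hrun
    have hxpre : x ∉ pre := fun h => by
      rw [hL, List.nodup_append] at hnd
      exact hnd.2.2 x h x List.mem_cons_self rfl
    obtain ⟨D₁, χ₁, V₁, inv₁⟩ :=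
      inv.step hsub hmono hα hβ hord hxpre (hlt pre x post hL) hstep
    exact ih (by rw [hL]; simp) inv₁ hrest

end Pass

/-! ### Summing the charges over all matroids -/

section Guarantee

variable {X : Type*} [DecidableEq X] {ι : Type*} {f : Finset X → ℝ}
  {M : ι → Matroid X} {ord : List X} {α β : ℝ} {Sinit : Finset X}

/-- A weighted sum over the matroids is bounded by counting the matroids of each element. -/
lemma sum_sum_filter_le {X ι : Type*} [Fintype ι] {T : Finset X} {b : X → ℝ}
    (R : X → ι → Prop) (n : ℝ)
    [∀ y, DecidablePred (R y)] [∀ ℓ, DecidablePred fun y => R y ℓ]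
    (hb : ∀ y ∈ T, 0 ≤ b y) (hR : ∀ y ∈ T, ((Finset.univ.filter (R y)).card : ℝ) ≤ n) :
    ∑ ℓ, ∑ y ∈ T.filter (fun y => R y ℓ), b y ≤ n * ∑ y ∈ T, b y := by
  simp_rw [Finset.sum_filter]
  rw [Finset.sum_comm, Finset.mul_sum]
  refine Finset.sum_le_sum fun y hy => ?_
  rw [← Finset.sum_filter, Finset.sum_const, nsmul_eq_mul]
  exact mul_le_mul_of_nonneg_right (hR y hy) (hb y hy)

/-- The weights charged to a single matroid. -/
lemma sum_charged_le (hmono : Monotone f) {S D O : Finset X} {χ : X → ℝ} {V : X → ι → Prop}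
    [∀ ℓ, DecidablePred fun y => y ∈ (M ℓ).E]
    [∀ ℓ, DecidablePred fun y => y ∈ (M ℓ).E ∧ ¬ V y ℓ]
    (hdisj : Disjoint S D) (hχ : ∀ y ∈ D, 0 ≤ χ y) (hO : Feasible M O) (ℓ : ι) (w : X → ℝ)
    (hw : ∀ x ∈ O, 0 < w x → x ∈ (M ℓ).closure (chargeable f M ord S D χ V ℓ (w x))) :
    ∑ x ∈ O, w x ≤ ∑ y ∈ S.filter (fun y => y ∈ (M ℓ).E), incr f ord y S +
      ∑ y ∈ D.filter (fun y => y ∈ (M ℓ).E ∧ ¬ V y ℓ), χ y := by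
  set Q₁ := S.filter (fun y => y ∈ (M ℓ).E) with hQ₁
  set Q₂ := D.filter (fun y => y ∈ (M ℓ).E ∧ ¬ V y ℓ) with hQ₂
  have hQ : Disjoint Q₁ Q₂ :=
    (hdisj.mono_left (Finset.filter_subset _ _)).mono_right (Finset.filter_subset _ _)
  have hDS : ∀ y ∈ D, y ∉ S := fun y hy h => Finset.disjoint_left.1 hdisj h hy
  set b : X → ℝ := fun y => if y ∈ S then incr f ord y S else χ y with hb
  have hbS : ∀ y ∈ S, b y = incr f ord y S := fun y hy => if_pos hy
  have hbD : ∀ y ∈ D, b y = χ y := fun y hy => if_neg (hDS y hy)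
  have hsum : ∑ y ∈ Q₁ ∪ Q₂, b y = ∑ y ∈ Q₁, incr f ord y S + ∑ y ∈ Q₂, χ y := by
    rw [Finset.sum_union hQ]
    congr 1
    · exact Finset.sum_congr rfl fun y hy => hbS y (Finset.mem_filter.1 hy).1
    · exact Finset.sum_congr rfl fun y hy => hbD y (Finset.mem_filter.1 hy).1
  rw [← hsum]
  -- A positive weight forces x into a closure, hence into the ground set.
  have hOE : ∑ x ∈ O, w x ≤ ∑ x ∈ O.filter (fun y => y ∈ (M ℓ).E), w x := by
    rw [Finset.sum_filter]
    refine Finset.sum_le_sum fun x hx => ?_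
    split_ifs with h
    · exact le_rfl
    · by_contra hpos
      exact h (Matroid.mem_ground_of_mem_closure (hw x hx (not_le.1 hpos)))
  refine hOE.trans (sum_le_sum_of_mem_closure (M ℓ) _ _ w b ?_ ?_ ?_)
  · exact (hO ℓ).subset fun x hx => Finset.mem_filter.1 (Finset.mem_coe.1 hx)
  · intro y hy
    rcases Finset.mem_union.1 hy with hy | hy
    · rw [hbS y (Finset.mem_filter.1 hy).1]
      exact incr_nonneg hmono _ _ _
    · rw [hbD y (Finset.mem_filter.1 hy).1]
      exact hχ y (Finset.mem_filter.1 hy).1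
  · intro x hx hpos
    refine (M ℓ).closure_subset_closure ?_ (hw x (Finset.mem_filter.1 hx).1 hpos)
    rintro y ⟨hyE, ⟨hyS, hθ⟩ | ⟨hyD, hyV, hθ⟩⟩
    · exact ⟨Finset.mem_union_left _ (Finset.mem_filter.2 ⟨hyS, hyE⟩), (hbS y hyS).symm ▸ hθ⟩
    · exact ⟨Finset.mem_union_right _ (Finset.mem_filter.2 ⟨hyD, hyE, hyV⟩),
        (hbD y hyD).symm ▸ hθ⟩

/-- The value of an independent set is bounded in terms of the final solution of a pass and the
values of the deleted elements. -/
lemma PassInvariant.value_le [Fintype ι] (hf : ∀ A, 0 ≤ f A) (hsub : IsSubmodular f)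
    (hmono : Monotone f)
    (hα : 0 ≤ α) (hβ : 0 < β) (hord : ∀ x, x ∈ ord) {p : ℕ} (hM : IsMatchoid p M)
    {L : List X} (hL : ∀ x, x ∈ L) {S D O : Finset X} {χ : X → ℝ} {V : X → ι → Prop}
    (inv : PassInvariant f M ord α β Sinit L S D χ V) (hO : Feasible M O) :
    f O ≤ f S + ∑ y ∈ D, χ y + O.card * α +
      (1 + β) * (p * f S + (p - 1) * ∑ y ∈ D, χ y) := by
  classical
  -- An independent set contains no loops, so the invariant applies to its elements.
  have hch : ∀ x ∈ O \ (S ∪ D), Charged f M ord α β S D χ V x := by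
    intro x hx
    obtain ⟨hxO, hxA⟩ := Finset.mem_sdiff.1 hx
    refine (inv.charged x (hL x) fun ℓ hℓ => ?_).resolve_left hxA
    exact (hO ℓ).subset (Set.singleton_subset_iff.2 ⟨hxO, hℓ⟩)
  choose! w hw hcl using hch
  have hO' : Feasible M (O \ (S ∪ D)) := fun ℓ =>
    (hO ℓ).subset fun x hx => ⟨(Finset.mem_sdiff.1 hx.1).1, hx.2⟩
  have hcard : ∀ y, (Finset.univ.filter (fun ℓ => y ∈ (M ℓ).E)).card ≤ p := by
    intro y
    have := hM y
    rwa [← Set.ncard_coe_finset, Finset.coe_filter_univ]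
  have hν : ∑ y ∈ S, incr f ord y S ≤ f S := by
    rw [sum_incr f S fun y _ => hord y]
    linarith [hf ∅]
  have h1 : f O ≤ f ((S ∪ D) ∪ (O \ (S ∪ D))) := hmono fun y hy => by simp [hy]
  have h2 := le_add_sum_marginal hsub hmono (S ∪ D) (O \ (S ∪ D))
  have h3 : ∑ x ∈ O \ (S ∪ D), marginal f x (S ∪ D) ≤
      (O \ (S ∪ D)).card * α + (1 + β) * ∑ ℓ, ∑ x ∈ O \ (S ∪ D), w x ℓ := by
    rw [Finset.sum_comm, Finset.mul_sum, ← nsmul_eq_mul, ← Finset.sum_const,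
      ← Finset.sum_add_distrib]
    exact Finset.sum_le_sum hw
  have h4 : ((O \ (S ∪ D)).card : ℝ) * α ≤ O.card * α :=
    mul_le_mul_of_nonneg_right (by exact_mod_cast Finset.card_le_card Finset.sdiff_subset) hα
  have h5 : ∑ ℓ, ∑ x ∈ O \ (S ∪ D), w x ℓ ≤
      ∑ ℓ, (∑ y ∈ S.filter (fun y => y ∈ (M ℓ).E), incr f ord y S +
        ∑ y ∈ D.filter (fun y => y ∈ (M ℓ).E ∧ ¬ V y ℓ), χ y) :=
    Finset.sum_le_sum fun ℓ _ => sum_charged_le hmono inv.disjoint inv.nonneg hO' ℓ _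
      fun x hx => hcl x hx ℓ
  have h6 : ∑ ℓ, ∑ y ∈ S.filter (fun y => y ∈ (M ℓ).E), incr f ord y S ≤
      p * ∑ y ∈ S, incr f ord y S :=
    sum_sum_filter_le (fun y ℓ => y ∈ (M ℓ).E) p (fun y _ => incr_nonneg hmono _ _ _)
      fun y _ => by exact_mod_cast hcard y
  have h7 : ∑ ℓ, ∑ y ∈ D.filter (fun y => y ∈ (M ℓ).E ∧ ¬ V y ℓ), χ y ≤
      ((p : ℝ) - 1) * ∑ y ∈ D, χ y := by
    refine sum_sum_filter_le (fun y ℓ => y ∈ (M ℓ).E ∧ ¬ V y ℓ) _ inv.nonneg fun y hy => ?_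
    obtain ⟨ℓ, hℓE, hℓV⟩ := inv.deleted y hy
    -- A deleted element was chosen for some matroid containing it and cannot be charged there; this
    -- is the source of p - 1.
    have hlt : (Finset.univ.filter (fun ℓ => y ∈ (M ℓ).E ∧ ¬ V y ℓ)).card <
        (Finset.univ.filter (fun ℓ => y ∈ (M ℓ).E)).card := by
      refine Finset.card_lt_card (Finset.ssubset_iff_of_subset ?_ |>.2 ⟨ℓ, ?_, ?_⟩)
      · exact fun m hm => by simp at hm ⊢; exact hm.1
      · simpa using hℓE
      · simp [hℓV]
    have : (Finset.univ.filter (fun ℓ => y ∈ (M ℓ).E ∧ ¬ V y ℓ)).card + 1 ≤ p :=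
      hlt.trans_le (hcard y)
    have h' : ((Finset.univ.filter (fun ℓ => y ∈ (M ℓ).E ∧ ¬ V y ℓ)).card : ℝ) + 1 ≤ p := by
      exact_mod_cast this
    linarith
  rw [Finset.sum_add_distrib] at h5
  have h8 : (p : ℝ) * ∑ y ∈ S, incr f ord y S ≤ p * f S :=
    mul_le_mul_of_nonneg_left hν (Nat.cast_nonneg p)
  have h9 := mul_le_mul_of_nonneg_left
    (by linarith : ∑ ℓ, ∑ x ∈ O \ (S ∪ D), w x ℓ ≤ p * f S + ((p : ℝ) - 1) * ∑ y ∈ D, χ y)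
    (by linarith : 0 ≤ 1 + β)
  linarith [inv.value_union]

end Guarantee

/-! ### The pretend order and the run over several passes -/

section Order

variable {X : Type*} [DecidableEq X]

/-- Cut the order just before x: the initial solution and the stream prefix already read all lie in
the front block, which does not contain x. -/
lemma idxOf_lt_of_notMem_init (A pre post : List X) (T : Finset X) (hA : ∀ y ∈ T, y ∈ A)
    (hAT : ∀ y ∈ A, y ∈ T) {x y : X} (hx : x ∉ T) (hxpre : x ∉ pre) (hy : y ∈ T ∨ y ∈ pre) :
    (A ++ (pre ++ x :: post).filter (fun z => z ∉ T)).idxOf y <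
      (A ++ (pre ++ x :: post).filter (fun z => z ∉ T)).idxOf x := by
  have hsplit : A ++ (pre ++ x :: post).filter (fun z => z ∉ T) =
      (A ++ pre.filter (fun z => z ∉ T)) ++ x :: post.filter (fun z => z ∉ T) := by
    simp [List.filter_append, hx]
  have hxl : x ∉ A ++ pre.filter (fun z => z ∉ T) := by
    simp only [List.mem_append, List.mem_filter, not_or, not_and]
    exact ⟨fun h => hx (hAT x h), fun h => absurd h hxpre⟩
  have hyl : y ∈ A ++ pre.filter (fun z => z ∉ T) := by
    by_cases hyT : y ∈ T
    · exact List.mem_append_left _ (hA y hyT)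
    · exact List.mem_append_right _ (List.mem_filter.2 ⟨hy.resolve_left hyT, by simpa using hyT⟩)
  rw [hsplit, List.idxOf_append_of_mem hyl, List.idxOf_append_of_notMem hxl]
  exact (List.idxOf_lt_length_of_mem hyl).trans_le (Nat.le_add_right _ _)

/-- The pretend order of each pass contains all elements. -/
lemma mem_pretendOrder {σ : ℕ → List X} {S : ℕ → Finset X} {d : ℕ} (hS0 : S 0 = ∅)
    (hσ : ∀ j, 1 ≤ j → j ≤ d → IsStream (σ j)) (i : ℕ) (hid : i + 1 ≤ d) (x : X) :
    x ∈ pretendOrder σ S (i + 1) := by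
  induction i with
  | zero => simpa [pretendOrder, hS0] using (hσ 1 le_rfl hid).2 x
  | succ i ih =>
    rw [pretendOrder, List.mem_append, List.mem_filter, List.mem_filter]
    by_cases hx : x ∈ S (i + 1)
    · exact Or.inl ⟨ih (by omega), by simpa using hx⟩
    · exact Or.inr ⟨(hσ (i + 1 + 1) (by omega) hid).2 x, by simpa using hx⟩

lemma mem_filter_pretendOrder {σ : ℕ → List X} {S : ℕ → Finset X} {d : ℕ} (hS0 : S 0 = ∅)
    (hσ : ∀ j, 1 ≤ j → j ≤ d → IsStream (σ j)) (i : ℕ) (hid : i ≤ d) (x : X) (hx : x ∈ S i) :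
    x ∈ (pretendOrder σ S i).filter (fun x => x ∈ S i) := by
  cases i with
  | zero => simp [hS0] at hx
  | succ i =>
    exact List.mem_filter.2 ⟨mem_pretendOrder hS0 hσ i hid x, by simpa using hx⟩

variable {ι : Type*} [Fintype ι] {f : Finset X → ℝ} {M : ι → Matroid X} {α : ℝ} {β : ℕ → ℝ}
  {d : ℕ} {σ : ℕ → List X} {S : ℕ → Finset X}

/-- The invariant at the end of a pass that starts from an independent set. -/
lemma MultipassLocalSearch.exists_passInvariant (hsub : IsSubmodular f) (hmono : Monotone f)
    (hα : 0 ≤ α) (hβ : ∀ j, 1 ≤ j → j ≤ d → 0 < β j)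
    (hσ : ∀ j, 1 ≤ j → j ≤ d → IsStream (σ j)) (hS : MultipassLocalSearch f M α β d σ S)
    (i : ℕ) (hid : i + 1 ≤ d) (hfeas : Feasible M (S i)) :
    ∃ D χ V, PassInvariant f M (pretendOrder σ S (i + 1)) α (β (i + 1)) (S i) (σ (i + 1))
      (S (i + 1)) D χ V := by
  have hnd := (hσ (i + 1) (by omega) hid).1
  refine (PassInvariant.start hfeas).run hsub hmono hα (hβ (i + 1) (by omega) hid)
    (mem_pretendOrder hS.1 hσ i hid) hnd ?_ (σ (i + 1)) rfl (hS.2 (i + 1) (by omega) hid)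
  intro pre x post hsplit hx y hy
  have hxpre : x ∉ pre := fun h => by
    rw [hsplit, List.nodup_append] at hnd
    exact hnd.2.2 x h x List.mem_cons_self rfl
  rw [pretendOrder, hsplit]
  exact idxOf_lt_of_notMem_init _ pre post (S i)
    (mem_filter_pretendOrder hS.1 hσ i (by omega))
    (fun y hy => by simpa using (List.mem_filter.1 hy).2) hx hxpre hy

/-- Every pass returns an independent set. -/
lemma MultipassLocalSearch.feasible (hsub : IsSubmodular f) (hmono : Monotone f)
    (hα : 0 ≤ α) (hβ : ∀ j, 1 ≤ j → j ≤ d → 0 < β j)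
    (hσ : ∀ j, 1 ≤ j → j ≤ d → IsStream (σ j)) (hS : MultipassLocalSearch f M α β d σ S)
    (i : ℕ) (hid : i ≤ d) : Feasible M (S i) := by
  induction i with
  | zero => exact fun ℓ => by simp [restr, hS.1]
  | succ i ih =>
    obtain ⟨D, χ, V, inv⟩ :=
      hS.exists_passInvariant hsub hmono hα hβ hσ i hid (ih (by omega))
    exact inv.feasible

end Order

end StreamingMatchoid

/-! ### The guarantee of a later pass -/

theorem mainTheorem5 {X : Type*} [Fintype X] [DecidableEq X] {ι : Type*} [Finite ι]
    (f : Finset X → ℝ) (hf_nonneg : ∀ A, 0 ≤ f A)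
    (hf_sub : StreamingMatchoid.IsSubmodular f) (hf_mono : Monotone f)
    (p : ℕ) (hp : 1 ≤ p) (M : ι → Matroid X) (hM : StreamingMatchoid.IsMatchoid p M)
    (k : ℕ) (hk : StreamingMatchoid.IsRank M k)
    (OPT : Finset X) (hOPT : StreamingMatchoid.IsOptimal f M OPT)
    (d : ℕ) (α : ℝ) (hα : 0 ≤ α)
    (β : ℕ → ℝ) (hβ : ∀ j, 1 ≤ j → j ≤ d → 0 < β j)
    (σ : ℕ → List X) (hσ : ∀ j, 1 ≤ j → j ≤ d → StreamingMatchoid.IsStream (σ j))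
    (S : ℕ → Finset X) (hS : StreamingMatchoid.MultipassLocalSearch f M α β d σ S)
    (i : ℕ) (hi : 1 < i) (hid : i ≤ d)
    (γ : ℝ) (hγ : f OPT ≤ γ * f (S (i - 1)))
    (δ : ℝ) (hδ : δ = f (S (i - 1)) / f (S i)) :
    f OPT ≤ min (γ * δ)
        (((p : ℝ) / β i + p - 1) * (1 - δ) + p + β i * p + 1) * f (S i) + k * α := by
  have := Fintype.ofFinite ι
  obtain ⟨j, rfl⟩ : ∃ j, i = j + 1 := ⟨i - 1, by omega⟩
  rw [Nat.add_sub_cancel] at hγ hδ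
  have hβi := hβ (j + 1) (by omega) hid
  obtain ⟨D, χ, V, inv⟩ := hS.exists_passInvariant hf_sub hf_mono hα hβ hσ j hid
    (hS.feasible hf_sub hf_mono hα hβ hσ j (by omega))
  have hD : 0 ≤ ∑ y ∈ D, χ y := Finset.sum_nonneg inv.nonneg
  have hinit := inv.value_init
  have hle : f (S j) ≤ f (S (j + 1)) := by
    have := mul_nonneg hβi.le hD
    linarith
  -- If f (S (j + 1)) = 0, then f (S j) = 0 by `hle`, so the identity survives division by zero.
  have hδS : δ * f (S (j + 1)) = f (S j) := by
    rcases (hf_nonneg (S (j + 1))).eq_or_lt with h0 | hpos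
    · have := hf_nonneg (S j)
      rw [← h0] at hle ⊢
      linarith
    · rw [hδ, div_mul_cancel₀ _ hpos.ne']
  have hkα : (OPT.card : ℝ) * α ≤ k * α :=
    mul_le_mul_of_nonneg_right (by exact_mod_cast hk.2 ⟨OPT, hOPT.1, rfl⟩) hα
  have hkα0 : 0 ≤ (k : ℝ) * α := mul_nonneg (Nat.cast_nonneg k) hα
  rw [min_mul_of_nonneg _ _ (hf_nonneg _), ← min_add_add_right, le_min_iff]
  constructor
  · rw [mul_assoc, hδS]
    linarith
  · have hval := inv.value_le hf_nonneg hf_sub hf_mono hα hβi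
      (StreamingMatchoid.mem_pretendOrder hS.1 hσ j hid) hM
      (hσ (j + 1) (by omega) hid).2 hOPT.1
    have hDle : ∑ y ∈ D, χ y ≤ (f (S (j + 1)) - f (S j)) / β (j + 1) := by
      rw [le_div_iff₀ hβi]
      linarith
    have hp' : (1 : ℝ) ≤ p := by exact_mod_cast hp
    -- The total coefficient of χ(D): 1 from f(S ∪ D), the rest from the charges. It equals p + β(p
    -- - 1), and dividing by β gives p/β + p - 1.
    have hcoef : 0 ≤ 1 + (1 + β (j + 1)) * ((p : ℝ) - 1) := by
      have := mul_nonneg (by linarith : 0 ≤ 1 + β (j + 1)) (sub_nonneg.2 hp')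
      linarith
    have hmul := mul_le_mul_of_nonneg_left hDle hcoef
    have hexp : (((p : ℝ) / β (j + 1) + p - 1) * (1 - δ) + p + β (j + 1) * p + 1) *
        f (S (j + 1)) = (1 + (1 + β (j + 1)) * ((p : ℝ) - 1)) *
          ((f (S (j + 1)) - f (S j)) / β (j + 1)) +
          (1 + (1 + β (j + 1)) * p) * f (S (j + 1)) := by
      rw [← hδS]
      field_simp
      ring
    rw [hexp]
    linarith
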